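/- Let $p$ be a prime, $q>1$ a power of $p$, $A=\mathbb{F}_q[t]$, $K=\mathbb{F}_q(t)$, and let $\wp\in A$ be an irreducible polynomial. Let $K_\wp$ be the $\wp$-adic completion of $K$, let $\mathbb{C}_\wp$ be the $\wp$-adic completion of an algebraic closure of $K_\wp$, and let $v_\wp$ be the additive valuation on $\mathbb{C}_\wp$ normalized by $v_\wp(\wp)=1$ (with $v_\wp(0)=+\infty$). Let $E/K_\wp$ be a finite extension inside $\mathbb{C}_\wp$ with ring of integers $\mathcal{O}_E$. For a square matrix $B$ over $\mathcal{O}_E$ and a rational number $a$, let $d(B,a)$ denote the number of eigenvalues $\lambda\in\mathbb{C}_\wp$ of $B$, counted with algebraic multiplicity, such that $v_\wp(\lambda)=a$. The elementary divisors of $B\in M_L(\mathcal{O}_E)$ are the values $s_1\le s_2\le\cdots\le s_L$ in $\mathbb{Q}\cup\{+\infty\}$ of $v_\wp$ at the diagonal entries of the Smith normal form of $B$. Let $d_0$, $n$ and $L$ be positive integers. Let $B\in M_L(\mathcal{O}_E)$ be a matrix whose elementary divisors $s_1\le\cdots\le s_L$ satisfy $$s_i\ \ge\ \left\lfloor\frac{i-1}{d_0}\right\rfloor\qquad\text{for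 all } 1\le i\le L,$$ and put $\varepsilon_0=d(B,0)$. Let $B'\in M_L(\mathcal{O}_E)$ be any matrix with $B'-B\in\wp^{p^n}M_L(\mathcal{O}_E)$. Suppose that 1. if $p=2$, then $n\ge 3$ or $d_0-\varepsilon_0\le 1$; 2. $2p^n>n(d_0n+2+d_0-2\varepsilon_0)$. Then, for any rational number $a$ with $0\le a\le n$, we have $$d(B,a)=d(B',a).$$ -/

import Mathlib

open Polynomial IsDedekindDomain

noncomputable section

namespace FunctionFieldAdic

variable {F : Type*} [Field F] (P : F[X]) [hP : Fact (Irreducible P)]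

/-- The place of `K = F(t)` attached to the irreducible polynomial `P ∈ A = F[t]`,
i.e. the prime ideal `(P)`. -/
def place : HeightOneSpectrum F[X] where
  asIdeal := Ideal.span {P}
  isPrime := (Ideal.span_singleton_prime hP.out.ne_zero).2 hP.out.prime
  ne_bot := by simpa using hP.out.ne_zero

/-- `K_P`: the `P`-adic completion of `K = F(t)`. -/
abbrev LocalField : Type _ := (place P).adicCompletion (RatFunc F)

/-- The `P`-adic valuation on `K_P`, read as a real number through `‖P‖ = 1/2`. The base of the
exponential is irrelevant: the additive valuation `addVal` below is normalized. -/
instance : (Valued.v : Valuation (LocalField P) (WithZero (Multiplicative ℤ))).RankOne :=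
  Valuation.IsRankOneDiscrete.rankOne _ (e := 2) one_lt_two

/-- The `P`-adic absolute value on `K_P`. -/
instance : NontriviallyNormedField (LocalField P) :=
  Valued.toNontriviallyNormedField (L := LocalField P) (Γ₀ := WithZero (Multiplicative ℤ))

instance : IsUltrametricDist (LocalField P) :=
  Valued.instIsUltrametricDist (LocalField P) (WithZero (Multiplicative ℤ))

/-- An algebraic closure of `K_P`. -/
abbrev LocalAlgClosure : Type _ := AlgebraicClosure (LocalField P)

/-- The unique extension of the `P`-adic absolute value to the algebraic closure of `K_P`. -/
instance : NontriviallyNormedField (LocalAlgClosure P) :=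
  spectralNorm.nontriviallyNormedField (LocalField P) (LocalAlgClosure P)

instance : NormedAlgebra (LocalField P) (LocalAlgClosure P) :=
  spectralNorm.normedAlgebra (LocalField P) (LocalAlgClosure P)

instance : UniformContinuousConstSMul (LocalField P) (LocalAlgClosure P) :=
  uniformContinuousConstSMul_of_continuousConstSMul _ _

/-- `ℂ_P`: the `P`-adic completion of an algebraic closure of `K_P`, with the absolute value
extending that of `K_P`. -/
abbrev CompletedAlgClosure : Type _ := UniformSpace.Completion (LocalAlgClosure P)

instance : IsUltrametricDist (CompletedAlgClosure P) :=
  IsUltrametricDist.of_normedAlgebra (LocalField P)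

/-- The polynomial `P` itself, as an element of `ℂ_P`. -/
def unif : CompletedAlgClosure P :=
  algebraMap (LocalField P) (CompletedAlgClosure P) (algebraMap F[X] (LocalField P) P)

theorem norm_unif_lt_one : ‖unif P‖ < 1 := by
  have h1 : ‖unif P‖ = ‖algebraMap F[X] (LocalField P) P‖ := norm_algebraMap' _ _
  rw [h1, Valued.toNormedField.norm_lt_one_iff,
    IsScalarTower.algebraMap_apply F[X] (RatFunc F) (LocalField P)]
  have h2 : (Valued.v : Valuation (LocalField P) (WithZero (Multiplicative ℤ)))
      (algebraMap (RatFunc F) (LocalField P) (algebraMap F[X] (RatFunc F) P)) =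
      (place P).valuation (RatFunc F) (algebraMap F[X] (RatFunc F) P) :=
    HeightOneSpectrum.valuedAdicCompletion_eq_valuation' _ _
  rw [h2, HeightOneSpectrum.valuation_lt_one_iff_mem]
  exact Ideal.mem_span_singleton_self P

theorem unif_ne_zero : unif P ≠ 0 := by
  rw [unif, IsScalarTower.algebraMap_apply F[X] (RatFunc F) (LocalField P), ne_eq, map_eq_zero,
    map_eq_zero, FaithfulSMul.algebraMap_eq_zero_iff]
  exact hP.out.ne_zero

open Classical in
/-- The additive valuation `v_P` on `ℂ_P` normalized by `v_P(P) = 1`, with `v_P(0) = +∞`. -/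
def addVal (x : CompletedAlgClosure P) : WithTop ℝ :=
  if x = 0 then ⊤ else ((Real.logb ‖unif P‖ ‖x‖ : ℝ) : WithTop ℝ)

theorem addVal_unif : addVal P (unif P) = 1 := by
  rw [addVal, if_neg (unif_ne_zero P), Real.logb_self_eq_one_iff.2]
  · rfl
  · have h0 := norm_pos_iff.2 (unif_ne_zero P)
    have h1 := norm_unif_lt_one P
    exact ⟨h0.ne', h1.ne, by linarith⟩

section FiniteExtension

variable {P} (E : IntermediateField (LocalField P) (CompletedAlgClosure P))

/-- The ring of integers `O_E` of a subextension `E` of `ℂ_P / K_P`: the elements of absolute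
value at most one. -/
def ringOfIntegers : ValuationSubring E :=
  (NormedField.valuation (K := CompletedAlgClosure P)).valuationSubring.comap
    (algebraMap E (CompletedAlgClosure P))

/-- The polynomial `P` as an element of `O_E`. -/
def unifInt : ringOfIntegers E :=
  ⟨algebraMap (LocalField P) E (algebraMap F[X] (LocalField P) P), (norm_unif_lt_one P).le⟩

variable {E}

open Classical in
/-- `d(T, a)` for an endomorphism `T` of a finite-dimensional `E`-vector space: the number of
eigenvalues of `T` in `ℂ_P` of slope (i.e. valuation) `a`, counted with algebraic multiplicity. -/
def slopeMult {V : Type*} [AddCommGroup V] [Module E V] [FiniteDimensional E V]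
    (T : Module.End E V) (a : ℚ) : ℕ :=
  ((T.charpoly.aroots (CompletedAlgClosure P)).filter
    fun x => addVal P x = (((a : ℚ) : ℝ) : WithTop ℝ)).card

/-- `d(B, a)` for a square matrix `B` over `O_E`: the invariant `d(T, a)` of the endomorphism `T`
of `E^L` represented by `B`. -/
def matrixSlopeMult {L : ℕ} (B : Matrix (Fin L) (Fin L) (ringOfIntegers E)) (a : ℚ) : ℕ :=
  slopeMult (Matrix.toLin' (B.map (algebraMap (ringOfIntegers E) E))) a

/-- `s` is the sequence `s 0 ≤ s 1 ≤ ⋯ ≤ s (L - 1)` of elementary divisors of `B`: the normalized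
valuations (possibly `+∞`) of the diagonal entries of a Smith normal form of `B`. -/
def IsElementaryDivisors {L : ℕ} (B : Matrix (Fin L) (Fin L) (ringOfIntegers E))
    (s : Fin L → WithTop ℝ) : Prop :=
  Monotone s ∧ ∃ (S T : GL (Fin L) (ringOfIntegers E)) (D : Fin L → ringOfIntegers E),
    S.val * B * T.val = Matrix.diagonal D ∧
      ∀ i, s i = addVal P (algebraMap E (CompletedAlgClosure P) (D i))

end FiniteExtension

end FunctionFieldAdic

end

/-! Put u = ‖℘‖, r = u^a, N = p^n, and compare the characteristic polynomials f of B and g of B'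
through the Gauss norm of radius r. The extreme exponents where this norm is attained count the
roots of absolute value < r and ≤ r, so the slope multiplicity is unchanged once g - f has smaller
Gauss norm than f (`Polynomial.countP_roots_norm_eq_of_sub_lt`).

The Gauss norm of f is ∏ max(r, |λ|) ≥ r^(L - ε₀), because the ε₀ unit eigenvalues contribute 1
each. For g - f, conjugating by the left Smith factor makes row i of B divisible by the i-th
elementary divisor. Expanding determinants and telescoping bounds it by u^N r⁻¹ ∏ max(r, u^⌊i/d₀⌋),
with i counted from 0.

It remains to show a + ∑ (a - ⌊i/d₀⌋)⁺ < N + aε₀. The left side minus aε₀ is convex in a and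
vanishes at a = 0, so a = n decides, and there the inequality follows from hypothesis 2
(`add_sum_max_sub_lt`). -/

/-! ### Gauss norms and the absolute values of roots. -/

section UltrametricPolynomial

variable {K : Type*} [NormedField K]

/-- The coefficients of `f` on the circle of radius `r` have size at most `C`, i.e. the Gauss norm
of `f` of radius `r` is at most `C`. -/
def CoeffBound (r C : ℝ) (f : K[X]) : Prop :=
  ∀ k, ‖f.coeff k‖ * r ^ k ≤ C

/-- The Gauss norm of `f` of radius `r` is `G`; it is attained at the exponents `m` and `M`, and
at no exponent outside `[m, M]`. -/
structure IsDominantRange (r G : ℝ) (m M : ℕ) (f : K[X]) : Prop where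
  bound : CoeffBound r G f
  left : ‖f.coeff m‖ * r ^ m = G
  right : ‖f.coeff M‖ * r ^ M = G
  lt_left : ∀ k < m, ‖f.coeff k‖ * r ^ k < G
  lt_right : ∀ k, M < k → ‖f.coeff k‖ * r ^ k < G

namespace IsDominantRange

variable {r G : ℝ} {m M m' M' : ℕ} {f g : K[X]}

theorem neg (h : IsDominantRange r G m M f) : IsDominantRange r G m M (-f) := by
  obtain ⟨h1, h2, h3, h4, h5⟩ := h
  constructor <;> simpa [CoeffBound] using by assumption

theorem unique (h : IsDominantRange r G m M f) (h' : IsDominantRange r G m' M' f) :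
    m = m' ∧ M = M' := by
  refine ⟨le_antisymm ?_ ?_, le_antisymm ?_ ?_⟩ <;> by_contra! hlt
  · exact (h.lt_left _ hlt).ne h'.left
  · exact (h'.lt_left _ hlt).ne h.left
  · exact (h'.lt_right _ hlt).ne h.right
  · exact (h.lt_right _ hlt).ne h'.right

theorem X_mul (hr : 0 < r) (hG : 0 < G) (h : IsDominantRange r G m M f) :
    IsDominantRange r (r * G) (m + 1) (M + 1) (X * f) := by
  have key : ∀ k, ‖(X * f).coeff (k + 1)‖ * r ^ (k + 1) = r * (‖f.coeff k‖ * r ^ k) := by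
    intro k; rw [coeff_X_mul]; ring
  have hz : ‖(X * f).coeff 0‖ * r ^ 0 = 0 := by simp
  refine ⟨?_, ?_, ?_, ?_, ?_⟩
  · rintro (_ | k)
    · rw [hz]; positivity
    · rw [key]; exact mul_le_mul_of_nonneg_left (h.bound k) hr.le
  · rw [key, h.left]
  · rw [key, h.right]
  · rintro (_ | k) hk
    · rw [hz]; positivity
    · rw [key]; exact mul_lt_mul_of_pos_left (h.lt_left k (by omega)) hr
  · rintro (_ | k) hk
    · rw [hz]; positivity
    · rw [key]; exact mul_lt_mul_of_pos_left (h.lt_right k (by omega)) hr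

theorem C_mul {x : K} (hx : x ≠ 0) (h : IsDominantRange r G m M f) :
    IsDominantRange r (‖x‖ * G) m M (C x * f) := by
  have hx' : 0 < ‖x‖ := norm_pos_iff.2 hx
  have key : ∀ k, ‖(C x * f).coeff k‖ * r ^ k = ‖x‖ * (‖f.coeff k‖ * r ^ k) := by
    intro k; rw [coeff_C_mul, norm_mul]; ring
  refine ⟨?_, ?_, ?_, ?_, ?_⟩
  · intro k; rw [key]; exact mul_le_mul_of_nonneg_left (h.bound k) hx'.le
  · rw [key, h.left]
  · rw [key, h.right]
  · intro k hk; rw [key]; exact mul_lt_mul_of_pos_left (h.lt_left k hk) hx'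
  · intro k hk; rw [key]; exact mul_lt_mul_of_pos_left (h.lt_right k hk) hx'

variable [IsUltrametricDist K]

theorem _root_.norm_coeff_add_mul_pow_le (hr : 0 < r) (f g : K[X]) (k : ℕ) :
    ‖(f + g).coeff k‖ * r ^ k ≤ max (‖f.coeff k‖ * r ^ k) (‖g.coeff k‖ * r ^ k) := by
  rw [coeff_add, ← max_mul_of_nonneg _ _ (by positivity)]
  exact mul_le_mul_of_nonneg_right (IsUltrametricDist.norm_add_le_max _ _) (by positivity)

theorem _root_.norm_coeff_add_mul_pow_eq (hr : 0 < r) (f g : K[X]) (k : ℕ)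
    (h : ‖g.coeff k‖ * r ^ k < ‖f.coeff k‖ * r ^ k) :
    ‖(f + g).coeff k‖ * r ^ k = ‖f.coeff k‖ * r ^ k := by
  have h' : ‖g.coeff k‖ < ‖f.coeff k‖ := lt_of_mul_lt_mul_right h (by positivity)
  rw [coeff_add, IsUltrametricDist.norm_add_eq_max_of_norm_ne_norm h'.ne', max_eq_left h'.le]

/-- By the ultrametric inequality, terms below G can neither cancel a dominant coefficient nor
create one. -/
theorem add_of_lt (hr : 0 < r) (h : IsDominantRange r G m M f)
    (hg : ∀ k, ‖g.coeff k‖ * r ^ k < G) : IsDominantRange r G m M (f + g) := by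
  have hle := norm_coeff_add_mul_pow_le hr f g
  refine ⟨fun k => (hle k).trans (max_le (h.bound k) (hg k).le), ?_, ?_, ?_, ?_⟩
  · rw [norm_coeff_add_mul_pow_eq hr _ _ _ (by rw [h.left]; exact hg m), h.left]
  · rw [norm_coeff_add_mul_pow_eq hr _ _ _ (by rw [h.right]; exact hg M), h.right]
  · exact fun k hk => (hle k).trans_lt (max_lt (h.lt_left k hk) (hg k))
  · exact fun k hk => (hle k).trans_lt (max_lt (h.lt_right k hk) (hg k))

theorem add (hr : 0 < r) (h : IsDominantRange r G m M f) (h' : IsDominantRange r G m' M' g)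
    (hm : m < m') (hM : M < M') : IsDominantRange r G m M' (f + g) := by
  have hle := norm_coeff_add_mul_pow_le hr f g
  refine ⟨fun k => (hle k).trans (max_le (h.bound k) (h'.bound k)), ?_, ?_, ?_, ?_⟩
  · rw [norm_coeff_add_mul_pow_eq hr _ _ _ (by rw [h.left]; exact h'.lt_left m hm), h.left]
  · rw [add_comm, norm_coeff_add_mul_pow_eq hr _ _ _ (by rw [h'.right]; exact h.lt_right M' hM),
      h'.right]
  · exact fun k hk => (hle k).trans_lt (max_lt (h.lt_left k hk) (h'.lt_left k (hk.trans hm)))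
  · exact fun k hk => (hle k).trans_lt (max_lt (h.lt_right k (hM.trans hk)) (h'.lt_right k hk))

/-- The Gauss norm of `∏ (X - x)`, with the exponents at which it is attained. -/
theorem prod_X_sub_C (hr : 0 < r) (s : Multiset K) :
    0 < (s.map fun x => max r ‖x‖).prod ∧
    IsDominantRange r (s.map fun x => max r ‖x‖).prod (s.countP fun x => ‖x‖ < r)
      (s.countP fun x => ‖x‖ ≤ r) (s.map fun x => X - C x).prod := by
  induction s using Multiset.induction_on with
  | empty =>
    have h1 : ∀ k : ℕ, 0 < k → ‖(1 : K[X]).coeff k‖ * r ^ k = 0 := by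
      intro k hk; simp [coeff_one, hk.ne']
    refine ⟨by simp, ?_, by simp, by simp, by simp, ?_⟩
    · rintro (_ | k)
      · simp
      · simpa using (h1 (k + 1) (by omega)).trans_le zero_le_one
    · intro k hk
      simpa using (h1 k (by simpa using hk)).trans_lt one_pos
  | cons x s ih =>
    obtain ⟨hG, h⟩ := ih
    simp only [Multiset.map_cons, Multiset.prod_cons]
    refine ⟨mul_pos (lt_max_of_lt_left hr) hG, ?_⟩
    have hX := h.X_mul hr hG
    -- Multiplication by `X` shifts the range by one, multiplication by `x` keeps it. The larger of
    -- the two wins; in a tie cancellation may occur inside, but the outer ends m and M + 1 survive.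
    rcases lt_trichotomy ‖x‖ r with hx | hx | hx
    · rw [Multiset.countP_cons_of_pos _ (by exact hx),
        Multiset.countP_cons_of_pos _ (by exact hx.le),
        max_eq_left hx.le, sub_mul, sub_eq_add_neg]
      refine hX.add_of_lt hr fun k => ?_
      rw [coeff_neg, norm_neg, coeff_C_mul, norm_mul, mul_assoc]
      exact (mul_le_mul_of_nonneg_left (h.bound k) (norm_nonneg x)).trans_lt
        (mul_lt_mul_of_pos_right hx hG)
    · rw [Multiset.countP_cons_of_neg _ (by exact hx.not_lt),
        Multiset.countP_cons_of_pos _ (by exact hx.le),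
        max_eq_left hx.le, sub_mul, ← neg_add_eq_sub]
      have hC := (h.C_mul (norm_pos_iff.1 (hx ▸ hr) : x ≠ 0)).neg
      rw [hx] at hC
      exact hC.add hr hX (Nat.lt_succ_self _) (Nat.lt_succ_self _)
    · rw [Multiset.countP_cons_of_neg _ (by exact hx.not_gt),
        Multiset.countP_cons_of_neg _ (by exact hx.not_ge),
        max_eq_right hx.le, sub_mul, ← neg_add_eq_sub]
      refine (h.C_mul (norm_pos_iff.1 (hr.trans hx) : x ≠ 0)).neg.add_of_lt hr fun k => ?_
      exact (hX.bound k).trans_lt (mul_lt_mul_of_pos_right hx hG)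

end IsDominantRange

theorem Multiset.countP_le_eq_add {α : Type*} (s : Multiset α) (u : α → ℝ) (r : ℝ) :
    s.countP (fun x => u x ≤ r) = s.countP (fun x => u x < r) + s.countP (fun x => u x = r) := by
  induction s using Multiset.induction_on with
  | empty => simp
  | cons x s ih =>
    simp only [Multiset.countP_cons, ih]
    rcases lt_trichotomy (u x) r with hx | hx | hx
    · simp [hx, hx.le, hx.ne]; omega
    · simp [hx]; omega
    · simp [hx.not_gt, hx.not_ge, hx.ne']

/-- A perturbation that is small for the Gauss norm of radius `r` does not change the number of
roots of absolute value `r`. -/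
theorem Polynomial.countP_roots_norm_eq_of_sub_lt [IsUltrametricDist K] {r : ℝ} (hr : 0 < r) {f g : K[X]}
    (hf : f.Monic) (hfs : f.Splits) (hg : g.Monic) (hgs : g.Splits)
    (h : ∀ k, ‖(g - f).coeff k‖ * r ^ k < (f.roots.map fun x => max r ‖x‖).prod) :
    f.roots.countP (fun x => ‖x‖ = r) = g.roots.countP (fun x => ‖x‖ = r) := by
  obtain ⟨-, hF⟩ := IsDominantRange.prod_X_sub_C hr f.roots
  obtain ⟨-, hG⟩ := IsDominantRange.prod_X_sub_C hr g.roots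
  rw [← hfs.eq_prod_roots_of_monic hf] at hF
  rw [← hgs.eq_prod_roots_of_monic hg] at hG
  have hF' := hF.add_of_lt hr h
  rw [add_sub_cancel] at hF'
  -- The Gauss norm of `g` is now known in two forms, one from the roots of `f`; they must agree
  -- before the ranges can be compared.
  have hnorm : ∀ {a b : ℝ} {m M m' M' : ℕ}, IsDominantRange r a m M g →
      IsDominantRange r b m' M' g → a ≤ b := fun h1 h2 => h1.left ▸ h2.bound _
  rw [le_antisymm (hnorm hF' hG) (hnorm hG hF')] at hF'
  obtain ⟨h1, h2⟩ := hF'.unique hG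
  rw [Multiset.countP_le_eq_add, Multiset.countP_le_eq_add] at h2
  omega

/-! ### Calculus of Gauss norm bounds. -/

namespace CoeffBound

variable {r C D : ℝ} {f g : K[X]}

theorem mono (h : CoeffBound r C f) (hCD : C ≤ D) : CoeffBound r D f :=
  fun k => (h k).trans hCD

theorem nonneg (h : CoeffBound r C f) : 0 ≤ C :=
  le_trans (by simp) (h 0)

theorem zero (hC : 0 ≤ C) : CoeffBound r C (0 : K[X]) := fun k => by simpa using hC

theorem neg (hf : CoeffBound r C f) : CoeffBound r C (-f) := fun k => by simpa using hf k

theorem const {x : K} (hx : ‖x‖ ≤ C) : CoeffBound r C (Polynomial.C x) := by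
  have hC : 0 ≤ C := (norm_nonneg x).trans hx
  rintro (_ | k)
  · simpa using hx
  · simpa [coeff_C] using hC

theorem X (hr : 0 < r) : CoeffBound r r (Polynomial.X : K[X]) := by
  intro k
  by_cases hk : k = 1
  · simp [hk]
  · simpa [coeff_X, Ne.symm hk] using hr.le

variable [IsUltrametricDist K]

theorem add (hr : 0 < r) (hf : CoeffBound r C f) (hg : CoeffBound r C g) :
    CoeffBound r C (f + g) :=
  fun k => (norm_coeff_add_mul_pow_le hr f g k).trans (max_le (hf k) (hg k))

theorem sum (hr : 0 < r) (hC : 0 ≤ C) {ι : Type*} (s : Finset ι) (F : ι → K[X])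
    (h : ∀ i ∈ s, CoeffBound r C (F i)) : CoeffBound r C (∑ i ∈ s, F i) :=
  Finset.sum_induction F (CoeffBound r C) (fun _ _ => add hr) (zero hC) h

theorem mul (hr : 0 < r) (hf : CoeffBound r C f) (hg : CoeffBound r D g) :
    CoeffBound r (C * D) (f * g) := by
  intro k
  have hCD : 0 ≤ C * D := mul_nonneg hf.nonneg hg.nonneg
  rw [coeff_mul, ← le_div_iff₀ (pow_pos hr k)]
  refine IsUltrametricDist.norm_sum_le_of_forall_le_of_nonneg (by positivity) fun ij hij => ?_
  rw [le_div_iff₀ (pow_pos hr k), norm_mul, ← Finset.HasAntidiagonal.mem_antidiagonal.1 hij, pow_add]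
  calc ‖f.coeff ij.1‖ * ‖g.coeff ij.2‖ * (r ^ ij.1 * r ^ ij.2)
      = (‖f.coeff ij.1‖ * r ^ ij.1) * (‖g.coeff ij.2‖ * r ^ ij.2) := by ring
    _ ≤ C * D := mul_le_mul (hf _) (hg _) (by positivity) hf.nonneg

theorem prod (hr : 0 < r) {ι : Type*} (s : Finset ι) (F : ι → K[X]) (ρ : ι → ℝ)
    (h : ∀ i ∈ s, CoeffBound r (ρ i) (F i)) :
    CoeffBound r (∏ i ∈ s, ρ i) (∏ i ∈ s, F i) := by
  classical
  induction s using Finset.induction_on with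
  | empty => simpa using const (r := r) (x := (1 : K)) norm_one.le
  | insert a s ha ih =>
    rw [Finset.prod_insert ha, Finset.prod_insert ha]
    exact (h a (Finset.mem_insert_self _ _)).mul hr
      (ih fun i hi => h i (Finset.mem_insert_of_mem hi))

/-- Telescoping: each term has one factor replaced by a difference of size δ. The missing ρ i is at
least r, so one factor r⁻¹ covers the loss. -/
theorem prod_sub_prod (hr : 0 < r) {ι : Type*} (s : Finset ι) (F F' : ι → K[X]) (ρ : ι → ℝ)
    {δ : ℝ} (hδ : 0 ≤ δ) (hρ : ∀ i, r ≤ ρ i) (hF : ∀ i, CoeffBound r (ρ i) (F i))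
    (hF' : ∀ i, CoeffBound r (ρ i) (F' i)) (hd : ∀ i, CoeffBound r δ (F' i - F i)) :
    CoeffBound r (δ * r⁻¹ * ∏ i ∈ s, ρ i) (∏ i ∈ s, F' i - ∏ i ∈ s, F i) := by
  classical
  induction s using Finset.induction_on with
  | empty => simpa using zero (K := K) (r := r) (by positivity : 0 ≤ δ * r⁻¹)
  | insert a s ha ih =>
    have hs : 0 ≤ ∏ i ∈ s, ρ i := Finset.prod_nonneg fun i _ => hr.le.trans (hρ i)
    rw [Finset.prod_insert ha, Finset.prod_insert ha, Finset.prod_insert ha,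
      show F' a * ∏ i ∈ s, F' i - F a * ∏ i ∈ s, F i =
        (F' a - F a) * ∏ i ∈ s, F i + F' a * (∏ i ∈ s, F' i - ∏ i ∈ s, F i) by ring]
    refine add hr ?_ ?_
    · refine ((hd a).mul hr (prod hr s F ρ fun i _ => hF i)).mono ?_
      have h1 : 1 ≤ r⁻¹ * ρ a := by
        rw [inv_mul_eq_div, one_le_div hr]; exact hρ a
      calc δ * ∏ i ∈ s, ρ i = δ * 1 * ∏ i ∈ s, ρ i := by ring
        _ ≤ δ * (r⁻¹ * ρ a) * ∏ i ∈ s, ρ i := by gcongr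
        _ = _ := by ring
    · exact ((hF' a).mul hr ih).mono (by ring_nf; rfl)

end CoeffBound

/-! ### Perturbation of characteristic polynomials. -/

/-- Perturbation of the characteristic polynomial of a matrix with small rows. -/
theorem Matrix.coeffBound_charpoly_sub_charpoly [IsUltrametricDist K] {ι : Type*} [Fintype ι] [DecidableEq ι]
    {r : ℝ} (hr : 0 < r) (A A' : Matrix ι ι K) (τ : ι → ℝ) {δ : ℝ} (hδ : δ ≤ r)
    (hδ₀ : 0 ≤ δ) (hA : ∀ i j, ‖A i j‖ ≤ τ i) (hA' : ∀ i j, ‖A' i j - A i j‖ ≤ δ) :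
    CoeffBound r (δ * r⁻¹ * ∏ i, max r (τ i)) (A'.charpoly - A.charpoly) := by
  have hρ : ∀ i, r ≤ max r (τ i) := fun i => le_max_left _ _
  have hprod : 0 ≤ ∏ i, max r (τ i) := Finset.prod_nonneg fun i _ => hr.le.trans (hρ i)
  have hX : ∀ i j : ι, CoeffBound r r (if i = j then X else 0 : K[X]) := by
    intro i j
    split_ifs
    · exact CoeffBound.X hr
    · exact CoeffBound.zero hr.le
  have hcoe : ∀ (B : Matrix ι ι K) i j,
      B.charmatrix i j = (if i = j then X else 0 : K[X]) + -C (B i j) := by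
    intro B i j
    rw [Matrix.charmatrix_apply, Matrix.diagonal_apply, sub_eq_add_neg]
  have hch : ∀ B : Matrix ι ι K, (∀ i j, ‖B i j‖ ≤ max r (τ i)) →
      ∀ i j, CoeffBound r (max r (τ i)) (B.charmatrix i j) := by
    intro B hB i j
    rw [hcoe]
    exact ((hX i j).mono (hρ i)).add hr (CoeffBound.const (hB i j)).neg
  have h1 := hch A fun i j => (hA i j).trans (le_max_right _ _)
  have h2 := hch A' fun i j => by
    rw [← sub_add_cancel (A' i j) (A i j)]
    exact (IsUltrametricDist.norm_add_le_max _ _).trans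
      (max_le_max ((hA' i j).trans hδ) (hA i j))
  rw [Matrix.charpoly, Matrix.charpoly, Matrix.det_apply, Matrix.det_apply,
    ← Finset.sum_sub_distrib]
  refine CoeffBound.sum hr (by positivity) _ _ fun σ _ => ?_
  -- The Leibniz term uses entries (σ i, i), so the row bounds are reindexed by σ.
  rw [← smul_sub, ← Equiv.prod_comp σ]
  have h3 : CoeffBound r (δ * r⁻¹ * ∏ i, max r (τ (σ i)))
      (∏ i, A'.charmatrix (σ i) i - ∏ i, A.charmatrix (σ i) i) := by
    refine CoeffBound.prod_sub_prod hr _ _ _ _ hδ₀ (fun i => hρ _) (fun i => h1 _ _)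
      (fun i => h2 _ _) fun i => ?_
    rw [hcoe, hcoe, add_sub_add_left_eq_sub, neg_sub_neg, ← C_sub]
    exact CoeffBound.const (by rw [norm_sub_rev]; exact hA' _ _)
  rcases Int.units_eq_one_or (Equiv.Perm.sign σ) with hσ | hσ
  · simpa [hσ] using h3
  · simpa [hσ] using h3.neg

end UltrametricPolynomial

/-! ### The numerical inequality. -/

section Counting

/-- The lattice-point bound `∑ (n - ⌊i / d⌋)⁺ ≤ d n (n + 1) / 2`. -/
theorem two_mul_sum_sub_div_le (d n L : ℕ) (hd : 0 < d) :
    2 * ∑ i ∈ Finset.range L, (n - i / d) ≤ d * (n * (n + 1)) := by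
  induction n with
  | zero => simp
  | succ n ih =>
    -- Raising n by one adds 1 for each i < d(n + 1), hence at most d(n + 1) in total.
    have h : ∀ i, n + 1 - i / d = (n - i / d) + if i < d * (n + 1) then 1 else 0 := by
      intro i
      have : i < d * (n + 1) ↔ i / d < n + 1 := by
        rw [Nat.div_lt_iff_lt_mul hd, mul_comm]
      simp only [this]
      split_ifs <;> omega
    simp only [h]
    rw [Finset.sum_add_distrib, Finset.sum_boole]
    have hc : ((Finset.range L).filter fun i => i < d * (n + 1)).card ≤ d * (n + 1) := by
      refine (Finset.card_le_card (t := Finset.range (d * (n + 1))) fun i hi => ?_).trans_eq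
        (Finset.card_range _)
      simpa using (Finset.mem_filter.1 hi).2
    push_cast
    nlinarith

/-- The bound at the slope `n` controls all slopes `a` in `[0, n]`, by convexity. -/
theorem add_sum_max_sub_lt (d n L ε N : ℕ) (hd : 0 < d) (hn : 0 < n) (hN : 0 < N)
    (h : (n : ℤ) * ((d : ℤ) * n + 2 + d - 2 * ε) < 2 * N) {a : ℝ} (ha₀ : 0 ≤ a) (han : a ≤ n) :
    a + ∑ i : Fin L, max (a - ((i / d : ℕ) : ℝ)) 0 < N + a * ε := by
  have hn' : (0 : ℝ) < n := by exact_mod_cast hn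
  have hN' : (0 : ℝ) < N := by exact_mod_cast hN
  -- Each (a - k)⁺ with k ≥ 0 is convex in a and zero at a = 0, so it lies below its chord over [0,
  -- n].
  have h1 : ∑ i : Fin L, max (a - ((i / d : ℕ) : ℝ)) 0 ≤
      a / n * ∑ i ∈ Finset.range L, ((n - i / d : ℕ) : ℝ) := by
    rw [← Fin.sum_univ_eq_sum_range (fun i => ((n - i / d : ℕ) : ℝ)), Finset.mul_sum]
    refine Finset.sum_le_sum fun i _ => max_le ?_ (by positivity)
    have h2 : (n : ℝ) - ((i / d : ℕ) : ℝ) ≤ ((n - i / d : ℕ) : ℝ) := by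
      rw [sub_le_iff_le_add]
      exact_mod_cast le_tsub_add
    refine le_trans ?_ (mul_le_mul_of_nonneg_left h2 (by positivity))
    rw [div_mul_eq_mul_div, le_div_iff₀ hn']
    have : (0 : ℝ) ≤ ((i / d : ℕ) : ℝ) := by positivity
    nlinarith
  have h3 : 2 * ∑ i ∈ Finset.range L, ((n - i / d : ℕ) : ℝ) ≤ d * (n * (n + 1)) := by
    exact_mod_cast two_mul_sum_sub_div_le d n L hd
  have h4 : (n : ℝ) * (d * n + 2 + d - 2 * ε) < 2 * N := by exact_mod_cast h
  set S := ∑ i ∈ Finset.range L, ((n - i / d : ℕ) : ℝ)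
  set x := a / n with hx
  have hxa : a = x * n := by rw [hx]; field_simp
  have hx₀ : 0 ≤ x := by positivity
  have hx₁ : x ≤ 1 := (div_le_one hn').2 han
  have h5 : n + S - n * ε < N := by nlinarith
  -- The bracket may be negative when ε is large; then 0 < N suffices.
  have h6 : x * (n + S - n * ε) < N := by
    rcases le_or_gt (n + S - n * ε) 0 with h0 | h0
    · nlinarith
    · nlinarith
  rw [hxa] at h1 ⊢
  nlinarith

end Counting

/-! ### Smith normal form and the multiplicative estimates. -/

section Ultrametric

/-- A matrix with Smith normal form `diag D` is conjugate to one whose rows are divisible by the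
entries of `D`. -/
theorem Matrix.conj_apply_eq_of_smith {ι R : Type*} [Fintype ι] [DecidableEq ι] [CommRing R]
    {S T : GL ι R} {B : Matrix ι ι R} {D : ι → R}
    (h : S.val * B * T.val = Matrix.diagonal D) (i j : ι) :
    (S.val * B * S⁻¹.val) i j = D i * (T⁻¹.val * S⁻¹.val) i j := by
  -- S B S⁻¹ = (S B T)(T⁻¹ S⁻¹).
  rw [← Matrix.diagonal_mul, ← h]
  simp only [Matrix.mul_assoc]
  rw [← Matrix.mul_assoc T.val, Units.mul_inv, Matrix.one_mul]

/-- Perturbation of the characteristic polynomial of an integral matrix with given Smith normal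
form. -/
theorem Matrix.coeffBound_charpoly_sub_charpoly_of_smith {ι R K : Type*} [Fintype ι]
    [DecidableEq ι] [CommRing R] [NormedField K] [IsUltrametricDist K] (φ : R →+* K)
    (hφ : ∀ x, ‖φ x‖ ≤ 1) {S T : GL ι R} {B B' W : Matrix ι ι R} {D : ι → R} {c : R}
    (h : S.val * B * T.val = Matrix.diagonal D) (hW : B' - B = c • W) {r : ℝ} (hr : 0 < r)
    (hc : ‖φ c‖ ≤ r) {τ : ι → ℝ} (hD : ∀ i, ‖φ (D i)‖ ≤ τ i) :
    CoeffBound r (‖φ c‖ * r⁻¹ * ∏ i, max r (τ i)) (B'.charpoly.map φ - B.charpoly.map φ) := by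
  -- The same S conjugates both matrices, so their difference stays divisible by `c`.
  rw [← Matrix.charpoly_units_conj S B, ← Matrix.charpoly_units_conj S B',
    ← Matrix.charpoly_map, ← Matrix.charpoly_map, ← Matrix.coe_units_inv]
  refine Matrix.coeffBound_charpoly_sub_charpoly hr _ _ _ hc (norm_nonneg _) ?_ ?_
  · intro i j
    rw [Matrix.map_apply, Matrix.conj_apply_eq_of_smith h, map_mul, norm_mul]
    exact (mul_le_of_le_one_right (norm_nonneg _) (hφ _)).trans (hD i)
  · intro i j
    rw [Matrix.map_apply, Matrix.map_apply, ← map_sub, ← Matrix.sub_apply, ← Matrix.sub_mul,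
      ← Matrix.mul_sub, hW, Matrix.mul_smul, Matrix.smul_mul, Matrix.smul_apply, smul_eq_mul,
      map_mul, norm_mul]
    exact mul_le_of_le_one_right (norm_nonneg _) (hφ _)

theorem pow_card_le_prod_max_mul_pow {α : Type*} (s : Multiset α) (u : α → ℝ) {r : ℝ}
    (hr : 0 < r) (hr₁ : r ≤ 1) :
    r ^ s.card ≤ (s.map fun x => max r (u x)).prod * r ^ s.countP fun x => u x = 1 := by
  induction s using Multiset.induction_on with
  | empty => simp
  | cons x s ih =>
    rw [Multiset.map_cons, Multiset.prod_cons, Multiset.card_cons, Multiset.countP_cons, pow_succ]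
    have hG : 0 ≤ (s.map fun x => max r (u x)).prod :=
      Multiset.prod_map_nonneg fun x _ => hr.le.trans (le_max_left _ _)
    split_ifs with hx
    · rw [hx, max_eq_right hr₁, one_mul, pow_succ, ← mul_assoc]
      exact mul_le_mul_of_nonneg_right ih hr.le
    · rw [add_zero, mul_assoc, mul_comm]
      exact mul_le_mul (le_max_left _ _) ih (by positivity) (hr.le.trans (le_max_left _ _))

/-- The multiplicative form of `add_sum_max_sub_lt`. -/
theorem mul_prod_max_rpow_lt (d n L ε N : ℕ) (hd : 0 < d) (hn : 0 < n) (hN : 0 < N)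
    (h : (n : ℤ) * ((d : ℤ) * n + 2 + d - 2 * ε) < 2 * N) {a : ℝ} (ha₀ : 0 ≤ a) (han : a ≤ n)
    {u : ℝ} (hu₀ : 0 < u) (hu₁ : u < 1) :
    u ^ N * (u ^ a)⁻¹ * (∏ i : Fin L, max (u ^ a) (u ^ ((i / d : ℕ) : ℝ))) * (u ^ a) ^ ε <
      (u ^ a) ^ L := by
  have hmax : ∀ i : Fin L, max (u ^ a) (u ^ ((i / d : ℕ) : ℝ)) =
      u ^ (a - max (a - ((i / d : ℕ) : ℝ)) 0) := by
    intro i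
    rcases le_total a ((i / d : ℕ) : ℝ) with h | h
    · rw [max_eq_right (sub_nonpos.2 h), sub_zero,
        max_eq_left (Real.rpow_le_rpow_of_exponent_ge hu₀ hu₁.le h)]
    · rw [max_eq_left (sub_nonneg.2 h), sub_sub_cancel,
        max_eq_right (Real.rpow_le_rpow_of_exponent_ge hu₀ hu₁.le h)]
  have hkey := add_sum_max_sub_lt d n L ε N hd hn hN h ha₀ han
  simp only [hmax]
  rw [← Real.rpow_sum_of_pos hu₀, ← Real.rpow_neg hu₀.le, ← Real.rpow_natCast u,
    ← Real.rpow_natCast (u ^ a), ← Real.rpow_natCast (u ^ a), ← Real.rpow_mul hu₀.le,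
    ← Real.rpow_mul hu₀.le, ← Real.rpow_add hu₀, ← Real.rpow_add hu₀, ← Real.rpow_add hu₀]
  refine Real.rpow_lt_rpow_of_exponent_gt hu₀ hu₁ ?_
  rw [Finset.sum_sub_distrib, Finset.sum_const, Finset.card_univ, Fintype.card_fin, nsmul_eq_mul]
  linarith

end Ultrametric

/-! ### Valuations and eigenvalues in ℂ_℘. -/

namespace FunctionFieldAdic

variable {F : Type*} [Field F] (P : F[X]) [hP : Fact (Irreducible P)]

theorem norm_unif_pos : 0 < ‖unif P‖ :=
  norm_pos_iff.2 (unif_ne_zero P)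

theorem addVal_eq_coe_iff (x : CompletedAlgClosure P) (a : ℝ) :
    addVal P x = (a : WithTop ℝ) ↔ ‖x‖ = ‖unif P‖ ^ a := by
  have h0 := norm_unif_pos P
  have h1 := norm_unif_lt_one P
  rw [addVal]
  split_ifs with hx
  · simp [hx, (Real.rpow_pos_of_pos h0 a).ne]
  · rw [WithTop.coe_inj, Real.logb_eq_iff_rpow_eq h0 h1.ne (norm_pos_iff.2 hx), eq_comm]

theorem norm_le_of_coe_le_addVal {x : CompletedAlgClosure P} {a : ℝ}
    (h : (a : WithTop ℝ) ≤ addVal P x) : ‖x‖ ≤ ‖unif P‖ ^ a := by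
  have h0 := norm_unif_pos P
  have h1 := norm_unif_lt_one P
  rw [addVal] at h
  split_ifs at h with hx
  · simpa [hx] using (Real.rpow_pos_of_pos h0 a).le
  · rwa [WithTop.coe_le_coe, Real.le_logb_iff_rpow_le_of_base_lt_one h0 h1
      (norm_pos_iff.2 hx)] at h

variable {P}

/-- An element of `ℂ_P` algebraic over `K_P` lies in the algebraic closure of `K_P`. -/
theorem mem_range_algebraMap_of_isIntegral {x : CompletedAlgClosure P}
    (hx : IsIntegral (LocalField P) x) :
    x ∈ (algebraMap (LocalAlgClosure P) (CompletedAlgClosure P)).range := by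
  have hs := IsAlgClosed.splits
    ((minpoly (LocalField P) x).map (algebraMap (LocalField P) (LocalAlgClosure P)))
  refine hs.mem_range_of_isRoot ((minpoly.monic hx).map _).ne_zero ?_
  rw [Polynomial.map_map, ← IsScalarTower.algebraMap_eq, IsRoot, eval_map_algebraMap,
    minpoly.aeval]

/-- The coefficients are algebraic over K_℘, so the polynomial descends to the algebraic closure and
splits already there. -/
theorem splits_map_algebraMap (E : IntermediateField (LocalField P) (CompletedAlgClosure P))
    [FiniteDimensional (LocalField P) E] (f : E[X]) :
    (f.map (algebraMap E (CompletedAlgClosure P))).Splits := by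
  have h : f.map (algebraMap E (CompletedAlgClosure P)) ∈
      Polynomial.lifts (algebraMap (LocalAlgClosure P) (CompletedAlgClosure P)) := by
    rw [lifts_iff_coeff_lifts]
    intro k
    rw [coeff_map]
    have hk : IsIntegral (LocalField P) (f.coeff k) := Algebra.IsIntegral.isIntegral _
    exact mem_range_algebraMap_of_isIntegral
      (hk.map (IsScalarTower.toAlgHom (LocalField P) E (CompletedAlgClosure P)))
  obtain ⟨g, hg⟩ := h
  rw [← hg]
  exact (IsAlgClosed.splits g).map _

variable {E : IntermediateField (LocalField P) (CompletedAlgClosure P)} {L : ℕ}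

/-- The embedding of `O_E` in `ℂ_P`. -/
noncomputable def integersEmbedding (E : IntermediateField (LocalField P) (CompletedAlgClosure P)) :
    ringOfIntegers E →+* CompletedAlgClosure P :=
  (algebraMap E (CompletedAlgClosure P)).comp (algebraMap (ringOfIntegers E) E)

theorem norm_integersEmbedding_le_one (x : ringOfIntegers E) : ‖integersEmbedding E x‖ ≤ 1 :=
  x.2

theorem integersEmbedding_unifInt : integersEmbedding E (unifInt E) = unif P := rfl

theorem splits_charpoly_map_integersEmbedding [FiniteDimensional (LocalField P) E]
    (B : Matrix (Fin L) (Fin L) (ringOfIntegers E)) :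
    (B.charpoly.map (integersEmbedding E)).Splits := by
  rw [integersEmbedding, ← Polynomial.map_map]
  exact splits_map_algebraMap E _

theorem matrixSlopeMult_eq_countP [FiniteDimensional (LocalField P) E]
    (B : Matrix (Fin L) (Fin L) (ringOfIntegers E)) (a : ℚ) :
    matrixSlopeMult B a =
      (B.charpoly.map (integersEmbedding E)).roots.countP fun x => ‖x‖ = ‖unif P‖ ^ (a : ℝ) := by
  classical
  rw [matrixSlopeMult, slopeMult, Matrix.charpoly_toLin', Matrix.charpoly_map, aroots_def,
    Polynomial.map_map, Multiset.countP_eq_card_filter]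
  simp only [addVal_eq_coe_iff]
  rw [integersEmbedding]

end FunctionFieldAdic

/-! ### The main theorem. -/

theorem proposition3p10 {p : ℕ} [Fact p.Prime] {F : Type*} [Field F] [Finite F] [CharP F p]
    (P : F[X]) [Fact (Irreducible P)]
    (E : IntermediateField (FunctionFieldAdic.LocalField P)
      (FunctionFieldAdic.CompletedAlgClosure P))
    [FiniteDimensional (FunctionFieldAdic.LocalField P) E]
    (d₀ n L ε₀ : ℕ) (hd₀ : 0 < d₀) (hn : 0 < n) (hL : 0 < L)
    (B B' : Matrix (Fin L) (Fin L) (FunctionFieldAdic.ringOfIntegers E))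
    (s : Fin L → WithTop ℝ) (hs : FunctionFieldAdic.IsElementaryDivisors B s)
    (hsd : ∀ i : Fin L, (((⌊((i : ℕ) : ℝ) / (d₀ : ℝ)⌋ : ℤ) : ℝ) : WithTop ℝ) ≤ s i)
    (hε₀ : ε₀ = FunctionFieldAdic.matrixSlopeMult B 0)
    (hBB' : ∃ W : Matrix (Fin L) (Fin L) (FunctionFieldAdic.ringOfIntegers E),
      B' - B = FunctionFieldAdic.unifInt E ^ (p ^ n) • W)
    (hlarge : p = 2 → 3 ≤ n ∨ (d₀ : ℤ) - (ε₀ : ℤ) ≤ 1)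
    (hsmall : (n : ℤ) * ((d₀ : ℤ) * n + 2 + d₀ - 2 * ε₀) < 2 * (p : ℤ) ^ n)
    (a : ℚ) (ha₀ : 0 ≤ a) (han : a ≤ n) :
    FunctionFieldAdic.matrixSlopeMult B a = FunctionFieldAdic.matrixSlopeMult B' a := by
  obtain ⟨-, S, T, D, hSBT, hsD⟩ := hs
  obtain ⟨W, hW⟩ := hBB'
  have hu₀ := FunctionFieldAdic.norm_unif_pos P
  have hu₁ := FunctionFieldAdic.norm_unif_lt_one P
  have hN : 0 < p ^ n := pow_pos (Nat.Prime.pos Fact.out) n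
  have hnN : n ≤ p ^ n := (Nat.lt_pow_self (Nat.Prime.one_lt Fact.out)).le
  have ha₀' : (0 : ℝ) ≤ a := by exact_mod_cast ha₀
  have han' : (a : ℝ) ≤ n := by exact_mod_cast han
  have hr₀ := Real.rpow_pos_of_pos hu₀ (a : ℝ)
  have hr₁ := Real.rpow_le_one hu₀.le hu₁.le ha₀'
  have hD : ∀ i, ‖FunctionFieldAdic.integersEmbedding E (D i)‖ ≤
      ‖FunctionFieldAdic.unif P‖ ^ ((i / d₀ : ℕ) : ℝ) := fun i => by
    refine FunctionFieldAdic.norm_le_of_coe_le_addVal P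
      ((le_of_eq ?_).trans ((hsd i).trans_eq (hsD i)))
    rw [← Nat.floor_div_eq_div (K := ℝ), natCast_floor_eq_intCast_floor (by positivity)]
  have hc : ‖FunctionFieldAdic.integersEmbedding E (FunctionFieldAdic.unifInt E ^ p ^ n)‖ =
      ‖FunctionFieldAdic.unif P‖ ^ p ^ n := by
    rw [map_pow, norm_pow, FunctionFieldAdic.integersEmbedding_unifInt]
  -- Since a ≤ n ≤ p^n, the perturbation is no larger than the radius.
  have hcr : ‖FunctionFieldAdic.unif P‖ ^ p ^ n ≤ ‖FunctionFieldAdic.unif P‖ ^ (a : ℝ) := by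
    rw [← Real.rpow_natCast]
    exact Real.rpow_le_rpow_of_exponent_ge hu₀ hu₁.le (han'.trans (by exact_mod_cast hnN))
  have hdiff := Matrix.coeffBound_charpoly_sub_charpoly_of_smith
    (FunctionFieldAdic.integersEmbedding E) FunctionFieldAdic.norm_integersEmbedding_le_one
    hSBT hW hr₀ (hc.trans_le hcr) hD
  rw [hc] at hdiff
  have hfs := FunctionFieldAdic.splits_charpoly_map_integersEmbedding B
  rw [FunctionFieldAdic.matrixSlopeMult_eq_countP, FunctionFieldAdic.matrixSlopeMult_eq_countP]
  refine countP_roots_norm_eq_of_sub_lt hr₀ (B.charpoly_monic.map _) hfs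
    (B'.charpoly_monic.map _) (FunctionFieldAdic.splits_charpoly_map_integersEmbedding B')
    fun k => (hdiff k).trans_lt ?_
  have hlow := pow_card_le_prod_max_mul_pow
    (B.charpoly.map (FunctionFieldAdic.integersEmbedding E)).roots (fun x => ‖x‖) hr₀ hr₁
  have hcount : (B.charpoly.map (FunctionFieldAdic.integersEmbedding E)).roots.countP
      (fun x => ‖x‖ = 1) = ε₀ := by
    rw [hε₀, FunctionFieldAdic.matrixSlopeMult_eq_countP, Rat.cast_zero, Real.rpow_zero]
  rw [hcount, ← hfs.natDegree_eq_card_roots, B.charpoly_monic.natDegree_map,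
    Matrix.charpoly_natDegree_eq_dim, Fintype.card_fin] at hlow
  -- Both bounds carry the factor r^ε₀, which avoids the subtraction L - ε₀ and is cancelled here.
  exact lt_of_mul_lt_mul_right ((mul_prod_max_rpow_lt d₀ n L ε₀ (p ^ n) hd₀ hn hN
    (by exact_mod_cast hsmall) ha₀' han' hu₀ hu₁).trans_le hlow) (pow_pos hr₀ ε₀).le
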